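/- Let $n\ge 1$ be an integer and $\alpha,\beta>-1$. Let $P_k^{(\alpha,\beta)}$ denote the monic Jacobi polynomial of degree $k$, i.e. the monic polynomials with $\int_{-1}^{1}P_k^{(\alpha,\beta)}(x)P_m^{(\alpha,\beta)}(x)(1-x)^{\alpha}(1+x)^{\beta}\,dx=0$ for $k\ne m$. For real polynomials $p$ of degree $m+1$ and $q$ of degree $m$, write $p\prec q$ if all zeros of $p$ and of $q$ are real and simple and, listed increasingly as $x_1<\dots<x_{m+1}$ and $y_1<\dots<y_m$, they satisfy $$x_1<y_1<x_2<y_2<\cdots<y_m<x_{m+1}.$$ Put $$M=\frac{2(n+1)(\alpha-\beta)}{(2n+\alpha+\beta+4)(2n+\alpha+\beta+2)},$$ $$\Delta=M^2+\frac{4}{(2n+\alpha+\beta+2)^2}\left[\frac{(\alpha-\beta)^2(\alpha+\beta+2)}{2n+\alpha+\beta+4}+\frac{4(n+\alpha+1)(n+\beta+1)(n+\alpha+\beta+2)}{2n+\alpha+\beta+3}\right],$$ $$E_1=\tfrac12\left[M-\sqrt{\Delta}\right],\qquad E_2=\tfrac12\left[M+\sqrt{\Delta}\right].$$ Assume that $P_n^{(\alpha,\beta)}$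 and $P_{n+1}^{(\alpha+1,\beta+1)}$ have no common zero. Then $$(x-E_1)(x-E_2)\,P_n^{(\alpha,\beta)}(x)\prec P_{n+1}^{(\alpha+1,\beta+1)}(x).$$ If, in addition, $E_1<y_1$ and $E_2>y_{n+1}$, where $y_1$ and $y_{n+1}$ are the smallest and the largest zero of $P_{n+1}^{(\alpha+1,\beta+1)}$, then $$P_{n+1}^{(\alpha+1,\beta+1)}\prec P_n^{(\alpha,\beta)}.$$ -/

import Mathlib

open Polynomial

/-- The Jacobi weight `(1 - x) ^ α * (1 + x) ^ β`, to be used on the interval `(-1, 1)`. -/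
noncomputable def jacobiWeight (α β x : ℝ) : ℝ := (1 - x) ^ α * (1 + x) ^ β

/-- The inner product of two polynomials for the measure `(1 - x) ^ α * (1 + x) ^ β dx` on
`(-1, 1)`. For `α, β > -1` the integrand is integrable, see `jacobi_intervalIntegrable`. -/
noncomputable def jacobiInner (α β : ℝ) (p q : ℝ[X]) : ℝ :=
  ∫ x in (-1 : ℝ)..1, p.eval x * q.eval x * jacobiWeight α β x

/-- The monic Jacobi polynomial `P_n^(α, β)`: the sequence of monic orthogonal polynomials for the
Jacobi measure, obtained from the monomials by the Gram–Schmidt process. The lemmas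
`monicJacobi_monic`, `monicJacobi_natDegree`, `monicJacobi_orthogonal` and `jacobiInner_self_pos`
below establish its defining properties. -/
noncomputable def monicJacobi (α β : ℝ) (n : ℕ) : ℝ[X] :=
  X ^ n - ∑ k : Fin n,
    C (jacobiInner α β (X ^ n) (monicJacobi α β k) /
      jacobiInner α β (monicJacobi α β k) (monicJacobi α β k)) * monicJacobi α β k
termination_by n
decreasing_by all_goals exact k.2

/-- `Interlaces p q` (written `p ≺ q`): for some `n`, the real polynomial `p` has degree `n + 1`
and exactly the `n + 1` distinct real zeros `x 0, …, x n`, the real polynomial `q` has degree `n`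
and exactly the `n` distinct real zeros `y 0, …, y (n - 1)`, and
`x 0 < y 0 < x 1 < y 1 < ⋯ < y (n - 1) < x n`. As the number of distinct zeros is the degree, all
zeros are simple and there are no non-real ones. -/
def Interlaces (p q : ℝ[X]) : Prop :=
  ∃ (n : ℕ) (x : Fin (n + 1) → ℝ) (y : Fin n → ℝ),
    p.natDegree = n + 1 ∧ q.natDegree = n ∧
    StrictMono x ∧ StrictMono y ∧
    (∀ t : ℝ, p.IsRoot t ↔ ∃ k, x k = t) ∧
    (∀ t : ℝ, q.IsRoot t ↔ ∃ k, y k = t) ∧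
    ∀ k : Fin n, x k.castSucc < y k ∧ y k < x k.succ

/-- The common centre term `2 (n + 1) (α - β) / ((2n + α + β + 4) (2n + α + β + 2))`. -/
noncomputable def jacobiM (n : ℕ) (α β : ℝ) : ℝ :=
  2 * (n + 1) * (α - β) / ((2 * n + α + β + 4) * (2 * n + α + β + 2))

/-- The discriminant `Δ`. -/
noncomputable def jacobiΔ (n : ℕ) (α β : ℝ) : ℝ :=
  jacobiM n α β ^ 2 +
    4 / (2 * n + α + β + 2) ^ 2 *
      ((α - β) ^ 2 * (α + β + 2) / (2 * n + α + β + 4) +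
        4 * (n + α + 1) * (n + β + 1) * (n + α + β + 2) / (2 * n + α + β + 3))

/-- The smaller of the two extra points. -/
noncomputable def jacobiE₁ (n : ℕ) (α β : ℝ) : ℝ :=
  1 / 2 * (jacobiM n α β - √(jacobiΔ n α β))

/-- The larger of the two extra points. -/
noncomputable def jacobiE₂ (n : ℕ) (α β : ℝ) : ℝ :=
  1 / 2 * (jacobiM n α β + √(jacobiΔ n α β))

theorem jacobiWeight_intervalIntegrable {α β : ℝ} (hα : -1 < α) (hβ : -1 < β) :
    IntervalIntegrable (jacobiWeight α β) MeasureTheory.volume (-1) 1 := by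
  have h1 : IntervalIntegrable (fun x : ℝ => (1 + x) ^ β) MeasureTheory.volume (-1) 0 := by
    have := (intervalIntegral.intervalIntegrable_rpow' (a := 0) (b := 1) hβ).comp_add_left 1
    simpa using this
  have h2 : IntervalIntegrable (fun x : ℝ => (1 - x) ^ α) MeasureTheory.volume 0 1 := by
    have := (intervalIntegral.intervalIntegrable_rpow' (a := 1) (b := 0) hα).comp_sub_left 1
    simpa using this
  refine IntervalIntegrable.trans (b := 0) ?_ ?_
  · refine h1.continuousOn_mul (g := fun x : ℝ => (1 - x) ^ α) ?_
    intro x hx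
    rw [Set.uIcc_of_le (by norm_num)] at hx
    refine ContinuousAt.continuousWithinAt ?_
    exact ContinuousAt.rpow_const (by fun_prop) (Or.inl (by linarith [hx.2]))
  · refine h2.mul_continuousOn (g := fun x : ℝ => (1 + x) ^ β) ?_
    intro x hx
    rw [Set.uIcc_of_le (by norm_num)] at hx
    refine ContinuousAt.continuousWithinAt ?_
    exact ContinuousAt.rpow_const (by fun_prop) (Or.inl (by linarith [hx.1]))

theorem jacobi_intervalIntegrable {α β : ℝ} (hα : -1 < α) (hβ : -1 < β) (p q : ℝ[X]) :
    IntervalIntegrable (fun x => p.eval x * q.eval x * jacobiWeight α β x)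
      MeasureTheory.volume (-1) 1 :=
  (jacobiWeight_intervalIntegrable hα hβ).continuousOn_mul
    (p.continuous.mul q.continuous).continuousOn

theorem jacobiInner_comm (α β : ℝ) (p q : ℝ[X]) : jacobiInner α β p q = jacobiInner α β q p := by
  simp only [jacobiInner, mul_comm (p.eval _)]

theorem jacobiInner_sub_left {α β : ℝ} (hα : -1 < α) (hβ : -1 < β) (p q r : ℝ[X]) :
    jacobiInner α β (p - q) r = jacobiInner α β p r - jacobiInner α β q r := by
  unfold jacobiInner
  rw [← intervalIntegral.integral_sub (jacobi_intervalIntegrable hα hβ p r)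
    (jacobi_intervalIntegrable hα hβ q r)]
  congr 1
  funext x
  rw [eval_sub]
  ring

theorem jacobiInner_sum_left {α β : ℝ} (hα : -1 < α) (hβ : -1 < β) {ι : Type*} (s : Finset ι)
    (c : ι → ℝ) (p : ι → ℝ[X]) (r : ℝ[X]) :
    jacobiInner α β (∑ i ∈ s, C (c i) * p i) r = ∑ i ∈ s, c i * jacobiInner α β (p i) r := by
  unfold jacobiInner
  simp_rw [← intervalIntegral.integral_const_mul]
  rw [← intervalIntegral.integral_finsetSum
    (fun i _ => (jacobi_intervalIntegrable hα hβ (p i) r).const_mul (c i))]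
  congr 1
  funext x
  simp only [eval_finsetSum, eval_mul, eval_C, Finset.sum_mul]
  exact Finset.sum_congr rfl fun i _ => by ring

theorem jacobiInner_self_pos {α β : ℝ} (hα : -1 < α) (hβ : -1 < β) {p : ℝ[X]} (hp : p ≠ 0) :
    0 < jacobiInner α β p p := by
  unfold jacobiInner
  have hle : (-1 : ℝ) ≤ 1 := by norm_num
  have hnn : 0 ≤ᵐ[MeasureTheory.volume.restrict (Set.Ioc (-1 : ℝ) 1)]
      fun x => p.eval x * p.eval x * jacobiWeight α β x := by
    refine MeasureTheory.ae_restrict_of_forall_mem measurableSet_Ioc fun x hx => ?_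
    exact mul_nonneg (mul_self_nonneg _) (mul_nonneg
      (Real.rpow_nonneg (by linarith [hx.2]) _) (Real.rpow_nonneg (by linarith [hx.1]) _))
  rw [intervalIntegral.integral_pos_iff_support_of_nonneg_ae' (by
    rwa [Set.uIoc_of_le hle]) (jacobi_intervalIntegrable hα hβ p p)]
  refine ⟨by norm_num, ?_⟩
  have hfin : MeasureTheory.volume (p.roots.toFinset : Set ℝ) = 0 :=
    p.roots.toFinset.finite_toSet.measure_zero _
  have hsub : Set.Ioo (-1 : ℝ) 1 \ (p.roots.toFinset : Set ℝ) ⊆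
      Function.support (fun x => p.eval x * p.eval x * jacobiWeight α β x) ∩ Set.Ioc (-1) 1 := by
    rintro x ⟨hx, hx'⟩
    have hr : p.eval x ≠ 0 := fun h => hx' (by simp [hp, h])
    refine ⟨?_, hx.1, hx.2.le⟩
    exact mul_ne_zero (mul_ne_zero hr hr) (mul_pos
      (Real.rpow_pos_of_pos (by linarith [hx.2]) _)
      (Real.rpow_pos_of_pos (by linarith [hx.1]) _)).ne'
  refine lt_of_lt_of_le ?_ (MeasureTheory.measure_mono hsub)
  rw [MeasureTheory.measure_sdiff_null hfin, Real.volume_Ioo]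
  norm_num

theorem monicJacobi_eq (α β : ℝ) (n : ℕ) :
    monicJacobi α β n = X ^ n - ∑ k : Fin n,
      C (jacobiInner α β (X ^ n) (monicJacobi α β k) /
        jacobiInner α β (monicJacobi α β k) (monicJacobi α β k)) * monicJacobi α β k := by
  rw [monicJacobi]

theorem monicJacobi_sum_degree_lt (α β : ℝ) (n : ℕ)
    (h : ∀ m < n, (monicJacobi α β m).degree = m) :
    (∑ k : Fin n, C (jacobiInner α β (X ^ n) (monicJacobi α β k) /
      jacobiInner α β (monicJacobi α β k) (monicJacobi α β k)) * monicJacobi α β k).degree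
      < (n : WithBot ℕ) := by
  refine (degree_sum_le _ _).trans_lt ((Finset.sup_lt_iff (WithBot.bot_lt_coe n)).2 ?_)
  intro k _
  rw [← smul_eq_C_mul]
  refine (degree_smul_le _ _).trans_lt ?_
  rw [h k k.2]
  exact WithBot.coe_lt_coe.2 (Nat.cast_lt.2 k.2)

theorem monicJacobi_degree (α β : ℝ) (n : ℕ) : (monicJacobi α β n).degree = n := by
  induction n using Nat.strong_induction_on with
  | _ n ih =>
    rw [monicJacobi, degree_sub_eq_left_of_degree_lt, degree_X_pow]
    rw [degree_X_pow]
    exact monicJacobi_sum_degree_lt α β n ih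

theorem monicJacobi_natDegree (α β : ℝ) (n : ℕ) : (monicJacobi α β n).natDegree = n :=
  natDegree_eq_of_degree_eq_some (monicJacobi_degree α β n)

theorem monicJacobi_monic (α β : ℝ) (n : ℕ) : (monicJacobi α β n).Monic := by
  rw [monicJacobi]
  exact (monic_X_pow n).sub_of_left (by
    rw [degree_X_pow]
    exact monicJacobi_sum_degree_lt α β n fun m _ => monicJacobi_degree α β m)

theorem monicJacobi_orthogonal_of_lt {α β : ℝ} (hα : -1 < α) (hβ : -1 < β) (n : ℕ) :
    ∀ m < n, jacobiInner α β (monicJacobi α β n) (monicJacobi α β m) = 0 := by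
  induction n using Nat.strong_induction_on with
  | _ n ih =>
    intro m hm
    have hpos := jacobiInner_self_pos hα hβ (monicJacobi_monic α β m).ne_zero
    rw [monicJacobi_eq α β n, jacobiInner_sub_left hα hβ, jacobiInner_sum_left hα hβ,
      Finset.sum_eq_single (⟨m, hm⟩ : Fin n)]
    · rw [div_mul_cancel₀ _ hpos.ne', sub_self]
    · intro k _ hk
      have hne : (k : ℕ) ≠ m := fun h => hk (Fin.ext h)
      rcases lt_or_gt_of_ne hne with h | h
      · rw [jacobiInner_comm α β (monicJacobi α β k) (monicJacobi α β m), ih m hm k h, mul_zero]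
      · rw [ih k k.2 m h, mul_zero]
    · simp

theorem monicJacobi_orthogonal {α β : ℝ} (hα : -1 < α) (hβ : -1 < β) {n m : ℕ} (h : n ≠ m) :
    jacobiInner α β (monicJacobi α β n) (monicJacobi α β m) = 0 := by
  rcases lt_or_gt_of_ne h with h | h
  · rw [jacobiInner_comm]
    exact monicJacobi_orthogonal_of_lt hα hβ m n h
  · exact monicJacobi_orthogonal_of_lt hα hβ n m h

/-! Write P for the monic Jacobi polynomial of degree n with parameters α, β, R for the one of
degree n with parameters α+1, β+1, and Q for the one of degree n+1 with parameters α+1, β+1.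
Everything reduces to signs at the zeros t of Q. There `monicJacobi_eval_of_isRoot` gives P(t) = -κ
(t - E₁)(t - E₂) R(t) with κ > 0, while `monicJacobi_mul_derivative_pos_of_isRoot`, for the raised
parameters, gives R(t) Q'(t) > 0.

Hence (t - E₁)(t - E₂) P(t) has the sign of -Q'(t); it is nonzero because P and Q share no zero. If
all zeros of Q lie strictly between E₁ and E₂, then P(t) itself has the sign of Q'(t). As Q'
alternates in sign along the zeros of Q, the intermediate value theorem and a degree count yield
both interlacings.

The identities at the zeros come from first-order relations between neighbouring Jacobi polynomials.
These rest on the fact that the Jacobi differential equation characterizes the monic polynomial of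
each degree. -/

/-! ### The Jacobi differential equation -/

/-- The Jacobi differential operator `(1 - x²) p'' + (β - α - (α + β + 2) x) p'`. -/
noncomputable def jacobiOp (α β : ℝ) (p : ℝ[X]) : ℝ[X] :=
  (1 - X ^ 2) * derivative (derivative p) + (C (β - α) - C (α + β + 2) * X) * derivative p

/-- The difference of the integrands is the derivative of (1-x)^(α+1) (1+x)^(β+1) (p'q - pq'), which
vanishes at ±1 because both exponents are positive. -/
theorem jacobiInner_jacobiOp {α β : ℝ} (hα : -1 < α) (hβ : -1 < β) (p q : ℝ[X]) :
    jacobiInner α β (jacobiOp α β p) q = jacobiInner α β p (jacobiOp α β q) := by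
  unfold jacobiInner
  rw [← sub_eq_zero, ← intervalIntegral.integral_sub (jacobi_intervalIntegrable hα hβ _ _)
    (jacobi_intervalIntegrable hα hβ _ _)]
  set r : ℝ[X] := derivative p * q - p * derivative q with hr
  have h := intervalIntegral.integral_eq_sub_of_hasDerivAt_of_le (a := -1) (b := 1)
    (f := fun x : ℝ => (1 - x) ^ (α + 1) * (1 + x) ^ (β + 1) * r.eval x)
    (f' := fun x : ℝ => eval x (jacobiOp α β p) * eval x q * jacobiWeight α β x -
      eval x p * eval x (jacobiOp α β q) * jacobiWeight α β x) (by norm_num) ?_ ?_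
    ((jacobi_intervalIntegrable hα hβ _ _).sub (jacobi_intervalIntegrable hα hβ _ _))
  · rw [h]
    simp [Real.zero_rpow (by linarith : α + 1 ≠ 0), Real.zero_rpow (by linarith : β + 1 ≠ 0)]
  · refine ContinuousOn.mul (ContinuousOn.mul ?_ ?_) r.continuous.continuousOn
    · exact ContinuousOn.rpow_const (by fun_prop) fun x _ => Or.inr (by linarith)
    · exact ContinuousOn.rpow_const (by fun_prop) fun x _ => Or.inr (by linarith)
  · rintro x ⟨hx1, hx2⟩
    have h1 : (1 - x) ≠ 0 := by linarith
    have h2 : (1 + x) ≠ 0 := by linarith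
    have d1 := ((hasDerivAt_id x).const_sub 1).rpow_const (p := α + 1) (Or.inl h1)
    have d2 := ((hasDerivAt_id x).const_add 1).rpow_const (p := β + 1) (Or.inl h2)
    have d := (d1.mul d2).mul (r.hasDerivAt x)
    refine d.congr_deriv ?_
    simp only [id, hr, jacobiWeight, jacobiOp, Pi.mul_apply, add_sub_cancel_right,
      Real.rpow_add_one h1, Real.rpow_add_one h2, eval_add, eval_sub, eval_mul, eval_C, eval_X,
      eval_pow, eval_one, derivative_sub, derivative_mul]
    ring

/-- Shows that the operator is triangular on monomials with eigenvalues -k(k+α+β+1); all later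
degree arguments use this. -/
theorem jacobiOp_coeff (α β : ℝ) (p : ℝ[X]) (k : ℕ) :
    (jacobiOp α β p).coeff k = (k + 2) * (k + 1) * p.coeff (k + 2) +
      (β - α) * (k + 1) * p.coeff (k + 1) - k * (k + α + β + 1) * p.coeff k := by
  have h : jacobiOp α β p = derivative (derivative p) - X ^ 2 * derivative (derivative p) +
      C (β - α) * derivative p - C (α + β + 2) * (X * derivative p) := by
    unfold jacobiOp; ring
  rw [h]
  simp only [coeff_add, coeff_sub, coeff_C_mul]
  rcases k with _ | _ | k
  · simp only [coeff_X_mul_zero, coeff_X_pow_mul', coeff_derivative]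
    push_cast
    norm_num
    ring
  · simp only [coeff_X_mul, coeff_X_pow_mul', coeff_derivative]
    push_cast
    norm_num
    ring
  · simp only [coeff_X_mul, coeff_X_pow_mul, coeff_derivative]
    push_cast
    ring

theorem jacobiInner_add_left {α β : ℝ} (hα : -1 < α) (hβ : -1 < β) (p q r : ℝ[X]) :
    jacobiInner α β (p + q) r = jacobiInner α β p r + jacobiInner α β q r := by
  unfold jacobiInner
  rw [← intervalIntegral.integral_add (jacobi_intervalIntegrable hα hβ p r)
    (jacobi_intervalIntegrable hα hβ q r)]
  congr 1
  funext x
  rw [eval_add]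
  ring

theorem jacobiInner_C_mul_left (α β c : ℝ) (p r : ℝ[X]) :
    jacobiInner α β (C c * p) r = c * jacobiInner α β p r := by
  unfold jacobiInner
  rw [← intervalIntegral.integral_const_mul]
  congr 1
  funext x
  rw [eval_mul, eval_C]
  ring

theorem monicJacobi_coeff_self (α β : ℝ) (n : ℕ) : (monicJacobi α β n).coeff n = 1 := by
  have := (monicJacobi_monic α β n).coeff_natDegree
  rwa [monicJacobi_natDegree] at this

theorem monicJacobi_coeff_of_lt (α β : ℝ) {n k : ℕ} (h : n < k) :
    (monicJacobi α β n).coeff k = 0 :=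
  coeff_eq_zero_of_natDegree_lt (by rwa [monicJacobi_natDegree])

theorem jacobiInner_monicJacobi_of_degree_lt {α β : ℝ} (hα : -1 < α) (hβ : -1 < β) (n : ℕ) :
    ∀ (m : ℕ), m ≤ n → ∀ q : ℝ[X], q.degree < m → jacobiInner α β q (monicJacobi α β n) = 0 := by
  intro m
  induction m with
  | zero =>
    intro _ q hq
    have : q = 0 := by
      rw [← degree_eq_bot]
      exact Nat.WithBot.lt_zero_iff.1 hq
    simp [this, jacobiInner]
  | succ m ih =>
    intro hm q hq
    -- Splitting off the top coefficient along the degree-m Jacobi polynomial lowers the degree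
    -- bound.
    have h : q = (q - C (q.coeff m) * monicJacobi α β m) + C (q.coeff m) * monicJacobi α β m := by
      ring
    rw [h, jacobiInner_add_left hα hβ, jacobiInner_C_mul_left,
      monicJacobi_orthogonal hα hβ (by omega : m ≠ n), mul_zero, add_zero]
    refine ih (by omega) _ ?_
    rw [degree_lt_iff_coeff_zero] at hq ⊢
    intro k hk
    rcases hk.eq_or_lt with rfl | hk
    · simp [monicJacobi_coeff_self]
    · simp [hq k hk, monicJacobi_coeff_of_lt α β hk]

/-- The residual r has degree below n, since the eigenvalue cancels its top coefficient. Symmetry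
moves the operator onto r without raising the degree, so orthogonality gives ⟨r, r⟩ = 0. -/
theorem monicJacobi_ode {α β : ℝ} (hα : -1 < α) (hβ : -1 < β) (n : ℕ) :
    jacobiOp α β (monicJacobi α β n) + C (n * (n + α + β + 1)) * monicJacobi α β n = 0 := by
  set P := monicJacobi α β n with hP
  set r := jacobiOp α β P + C (n * (n + α + β + 1)) * P with hr
  by_contra hne
  have hdeg : r.degree < n := by
    rw [degree_lt_iff_coeff_zero]
    intro k hk
    rw [hr, coeff_add, coeff_C_mul, jacobiOp_coeff, hP,
      monicJacobi_coeff_of_lt α β (by omega : n < k + 2),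
      monicJacobi_coeff_of_lt α β (by omega : n < k + 1)]
    rcases hk.eq_or_lt with rfl | hk
    · ring
    · rw [monicJacobi_coeff_of_lt α β hk]
      ring
  have hdeg' : (jacobiOp α β r).degree < n := by
    rw [degree_lt_iff_coeff_zero] at hdeg ⊢
    intro k hk
    rw [jacobiOp_coeff, hdeg _ hk, hdeg _ (by omega), hdeg _ (by omega)]
    ring
  have hpos := jacobiInner_self_pos hα hβ hne
  have : jacobiInner α β r r = 0 := by
    nth_rw 1 [hr]
    rw [jacobiInner_add_left hα hβ, jacobiInner_C_mul_left, jacobiInner_jacobiOp hα hβ,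
      jacobiInner_comm, jacobiInner_comm _ _ P,
      jacobiInner_monicJacobi_of_degree_lt hα hβ n n le_rfl _ hdeg',
      jacobiInner_monicJacobi_of_degree_lt hα hβ n n le_rfl _ hdeg]
    ring
  linarith

theorem jacobiOp_sub (α β : ℝ) (p q : ℝ[X]) :
    jacobiOp α β (p - q) = jacobiOp α β p - jacobiOp α β q := by
  simp only [jacobiOp, derivative_sub]
  ring

/-- The Jacobi differential equation determines the monic polynomial solution. -/
theorem eq_monicJacobi_of_ode {α β : ℝ} (hα : -1 < α) (hβ : -1 < β) {n : ℕ} {p : ℝ[X]}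
    (hp : p.coeff n = 1) (hdeg : p.natDegree ≤ n)
    (hode : jacobiOp α β p + C (n * (n + α + β + 1)) * p = 0) : p = monicJacobi α β n := by
  rw [← sub_eq_zero]
  set d := p - monicJacobi α β n with hd
  have hdode : jacobiOp α β d + C (n * (n + α + β + 1)) * d = 0 := by
    rw [hd, jacobiOp_sub]
    linear_combination hode - monicJacobi_ode hα hβ n
  have hdn : ∀ k, n ≤ k → d.coeff k = 0 := by
    intro k hk
    rcases hk.eq_or_lt with rfl | hk
    · simp [hd, hp, monicJacobi_coeff_self]
    · simp [hd, monicJacobi_coeff_of_lt α β hk, coeff_eq_zero_of_natDegree_lt (hdeg.trans_lt hk)]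
  by_contra hne
  have hlt : d.natDegree < n := by
    by_contra h
    exact hne (leadingCoeff_eq_zero.1 (hdn _ (not_lt.1 h)))
  have hc := congrArg (fun r => r.coeff d.natDegree) hdode
  simp only [coeff_add, coeff_C_mul, jacobiOp_coeff, coeff_zero,
    coeff_eq_zero_of_natDegree_lt (by omega : d.natDegree < d.natDegree + 2),
    coeff_eq_zero_of_natDegree_lt (by omega : d.natDegree < d.natDegree + 1)] at hc
  have hl : d.coeff d.natDegree ≠ 0 := by simpa using hne
  have h1 : (d.natDegree : ℝ) + 1 ≤ n := by exact_mod_cast hlt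
  have h0 : (0 : ℝ) ≤ d.natDegree := by positivity
  -- The first two factors are the difference of the eigenvalues at n and at deg d < n, which is
  -- positive as α, β > -1.
  have : (((n : ℝ) - d.natDegree) * (n + d.natDegree + α + β + 1)) * d.coeff d.natDegree = 0 := by
    linear_combination hc
  refine (mul_ne_zero (mul_ne_zero ?_ ?_) hl) this <;> linarith

/-! ### Interlacing from sign changes -/

/-- Each gap between nodes contains a zero by the intermediate value theorem, and the degree leaves
room for no other. The sign is normalized to be positive at the last node. -/
theorem exists_roots_of_alternating {N : ℕ} {p : ℝ[X]} (hp : p.natDegree = N)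
    {z : Fin (N + 1) → ℝ} (hz : StrictMono z)
    (hs : ∀ k : Fin (N + 1), 0 < (-1 : ℝ) ^ (N + (k : ℕ)) * p.eval (z k)) :
    ∃ x : Fin N → ℝ, StrictMono x ∧ (∀ t, p.IsRoot t ↔ ∃ k, x k = t) ∧
      ∀ k : Fin N, z k.castSucc < x k ∧ x k < z k.succ := by
  have hroot : ∀ k : Fin N, ∃ x, (z k.castSucc < x ∧ x < z k.succ) ∧ p.IsRoot x := by
    intro k
    have h1 := hs k.castSucc
    have h2 := hs k.succ
    simp only [Fin.val_castSucc, Fin.val_succ, ← add_assoc, pow_succ] at h1 h2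
    have hle : z k.castSucc ≤ z k.succ := hz.monotone k.castSucc_lt_succ.le
    rcases neg_one_pow_eq_or ℝ (N + k) with h | h <;> rw [h] at h1 h2
    · obtain ⟨x, hx, hx0⟩ := intermediate_value_Ioo' hle p.continuous.continuousOn
        (show (0 : ℝ) ∈ _ from ⟨by linarith, by linarith⟩)
      exact ⟨x, hx, hx0⟩
    · obtain ⟨x, hx, hx0⟩ := intermediate_value_Ioo hle p.continuous.continuousOn
        (show (0 : ℝ) ∈ _ from ⟨by linarith, by linarith⟩)
      exact ⟨x, hx, hx0⟩
  choose x hx hxr using hroot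
  have hmono : StrictMono x := by
    intro i j hij
    refine (hx i).2.trans_le ((hz.monotone ?_).trans (hx j).1.le)
    rw [Fin.le_def]
    simpa using hij
  have hp0 : p ≠ 0 := by
    rintro rfl
    simpa using hs 0
  refine ⟨x, hmono, fun t => ⟨fun ht => ?_, ?_⟩, hx⟩
  · by_contra hne
    push Not at hne
    have hcard : (insert t (Finset.univ.image x)).card = N + 1 := by
      rw [Finset.card_insert_of_notMem (by simpa using hne),
        Finset.card_image_of_injective _ hmono.injective, Finset.card_univ, Fintype.card_fin]
    have hsub : insert t (Finset.univ.image x) ⊆ p.roots.toFinset := by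
      intro u hu
      rw [Multiset.mem_toFinset, mem_roots hp0]
      rcases Finset.mem_insert.1 hu with rfl | hu
      · exact ht
      · obtain ⟨k, -, rfl⟩ := Finset.mem_image.1 hu
        exact hxr k
    have := (Finset.card_le_card hsub).trans
      ((Multiset.toFinset_card_le _).trans (card_roots' p))
    omega
  · rintro ⟨k, rfl⟩
    exact hxr k

theorem eq_nodal_of_roots {m : ℕ} {q : ℝ[X]} (hq : q.Monic) (hdeg : q.natDegree = m)
    {y : Fin m → ℝ} (hy : StrictMono y) (hr : ∀ t, q.IsRoot t ↔ ∃ k, y k = t) :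
    q = Lagrange.nodal Finset.univ y := by
  refine eq_of_monic_of_dvd_of_natDegree_le Lagrange.nodal_monic hq ?_ ?_
  · rw [Lagrange.nodal]
    refine Finset.prod_dvd_of_coprime (fun i _ j _ hij => ?_) fun i _ => ?_
    · exact isCoprime_X_sub_C_of_isUnit_sub (sub_ne_zero.2 (hy.injective.ne hij)).isUnit
    · exact dvd_iff_isRoot.2 ((hr _).2 ⟨i, rfl⟩)
  · rw [Lagrange.natDegree_nodal, hdeg]
    simp

theorem neg_one_pow_mul_eval_derivative_pos {m : ℕ} {q : ℝ[X]} (hq : q.Monic)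
    (hdeg : q.natDegree = m) {y : Fin m → ℝ} (hy : StrictMono y)
    (hr : ∀ t, q.IsRoot t ↔ ∃ k, y k = t) (k : Fin m) :
    0 < (-1 : ℝ) ^ (m + (k : ℕ) + 1) * (derivative q).eval (y k) := by
  rw [eq_nodal_of_roots hq hdeg hy hr,
    Lagrange.eval_nodal_derivative_eval_node_eq (Finset.mem_univ k), Lagrange.eval_nodal]
  -- q'(y k) is the product of the differences y k - y j, of which the m - 1 - k with j > k are
  -- negative; the exponent has the same parity.
  have h1 : (-1 : ℝ) ^ (m + (k : ℕ) + 1) =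
      ∏ j ∈ Finset.univ.erase k, if k < j then (-1 : ℝ) else 1 := by
    rw [← Finset.prod_filter, Finset.prod_const]
    have : (Finset.univ.erase k).filter (fun j => k < j) = Finset.Ioi k := by
      ext j
      simp only [Finset.mem_filter, Finset.mem_erase, Finset.mem_univ, Finset.mem_Ioi]
      grind
    rw [this, Fin.card_Ioi]
    have hk := k.2
    rw [show m + (k : ℕ) + 1 = (m - 1 - k) + 2 * (k + 1) by omega, pow_add, pow_mul]
    simp
  rw [h1, ← Finset.prod_mul_distrib]
  refine Finset.prod_pos fun j hj => ?_
  rcases lt_or_gt_of_ne (Finset.ne_of_mem_erase hj) with h | h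
  · rw [if_neg h.not_gt]
    linarith [hy h]
  · rw [if_pos h]
    linarith [hy h]

/-- If `p` has degree one less than `q` and the sign of `q'` at the zeros of `q`, then `q ≺ p`. -/
theorem interlaces_of_eval_derivative_pos {m : ℕ} {p q : ℝ[X]} (hp : p.natDegree = m)
    (hq : q.Monic) (hqd : q.natDegree = m + 1) {y : Fin (m + 1) → ℝ} (hy : StrictMono y)
    (hr : ∀ t, q.IsRoot t ↔ ∃ k, y k = t)
    (hs : ∀ k, 0 < p.eval (y k) * (derivative q).eval (y k)) : Interlaces q p := by
  obtain ⟨x, hx, hxr, hxy⟩ := exists_roots_of_alternating hp hy (fun k => by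
    have h := neg_one_pow_mul_eval_derivative_pos hq hqd hy hr k
    have h' := hs k
    rw [show m + 1 + (k : ℕ) + 1 = m + k + 2 by ring, pow_add, neg_one_sq, mul_one] at h
    rcases neg_one_pow_eq_or ℝ (m + k) with e | e <;> rw [e] at h ⊢ <;> nlinarith)
  exact ⟨m, y, x, hqd, hp, hy, hx, hr, hxr, hxy⟩

/-- If `p` has degree one more than `q`, the sign of `-q'` at the zeros of `q` and the right signs
at `a < b`, then its zeros lie in `(a, b)` and interlace with those of `q`. -/
theorem exists_roots_of_eval_derivative_neg {m : ℕ} {p q : ℝ[X]} (hp : p.natDegree = m + 1)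
    (hq : q.Monic) (hqd : q.natDegree = m) {y : Fin m → ℝ} (hy : StrictMono y)
    (hr : ∀ t, q.IsRoot t ↔ ∃ k, y k = t)
    (hs : ∀ k, p.eval (y k) * (derivative q).eval (y k) < 0) {a b : ℝ} (hab : a < b)
    (hya : ∀ k, a < y k) (hyb : ∀ k, y k < b) (ha : 0 < (-1 : ℝ) ^ (m + 1) * p.eval a)
    (hb : 0 < p.eval b) :
    ∃ x : Fin (m + 1) → ℝ, StrictMono x ∧ (∀ t, p.IsRoot t ↔ ∃ k, x k = t) ∧
      (∀ k, a < x k ∧ x k < b) ∧ ∀ k : Fin m, x k.castSucc < y k ∧ y k < x k.succ := by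
  -- The nodes are a, the zeros of q, and b: one more than the degree of p.
  set z : Fin (m + 2) → ℝ := Fin.cons a (Fin.snoc y b : Fin (m + 1) → ℝ) with hz
  have hz0 : z 0 = a := rfl
  have hzl : z (Fin.last (m + 1)) = b := by
    rw [← Fin.succ_last, hz, Fin.cons_succ, Fin.snoc_last]
  have hzm : ∀ k : Fin m, z k.castSucc.succ = y k := by
    intro k
    rw [hz, Fin.cons_succ, Fin.snoc_castSucc]
  have hmono : StrictMono z := by
    have h1 : StrictMono (Fin.snoc y b : Fin (m + 1) → ℝ) := by
      intro i j hij
      induction j using Fin.lastCases with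
      | last =>
        induction i using Fin.lastCases with
        | last => exact absurd hij (lt_irrefl _)
        | cast i => simpa using hyb i
      | cast j =>
        induction i using Fin.lastCases with
        | last => exact absurd hij (Fin.castSucc_lt_last j).not_gt
        | cast i => simpa using hy (Fin.castSucc_lt_castSucc_iff.1 hij)
    have h2 : ∀ i, a < (Fin.snoc y b : Fin (m + 1) → ℝ) i := by
      intro i
      induction i using Fin.lastCases with
      | last => simpa using hab
      | cast i => simpa using hya i
    intro i j hij
    induction j using Fin.cases with
    | zero => exact absurd hij (Fin.not_lt_zero i)
    | succ j =>
      induction i using Fin.cases with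
      | zero => simpa [hz] using h2 j
      | succ i => simpa [hz] using h1 (Fin.succ_lt_succ_iff.1 hij)
  obtain ⟨x, hx, hxr, hxz⟩ := exists_roots_of_alternating hp hmono (by
    intro k
    induction k using Fin.cases with
    | zero => simpa [hz0] using ha
    | succ k =>
      induction k using Fin.lastCases with
      | last =>
        rw [Fin.succ_last, hzl, Fin.val_last, ← two_mul, pow_mul]
        simpa using hb
      | cast k =>
        rw [hzm, Fin.val_succ, Fin.val_castSucc]
        have h := neg_one_pow_mul_eval_derivative_pos hq hqd hy hr k
        have h' := hs k
        rw [pow_succ] at h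
        rw [show m + 1 + ((k : ℕ) + 1) = m + k + 2 by ring, pow_add, neg_one_sq, mul_one]
        rcases neg_one_pow_eq_or ℝ (m + k) with e | e <;> rw [e] at h ⊢ <;> nlinarith)
  refine ⟨x, hx, hxr, fun k => ⟨?_, ?_⟩, fun k => ⟨?_, ?_⟩⟩
  · exact ((hmono.monotone (Fin.zero_le _)).trans_lt (hxz k).1)
  · have := (hxz k).2.trans_le (hmono.monotone (Fin.le_last _))
    rwa [hzl] at this
  · have := (hxz k.castSucc).2
    rwa [hzm] at this
  · have := (hxz k.succ).1
    rwa [← Fin.succ_castSucc, hzm] at this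

theorem eval_pos_of_roots_lt {m : ℕ} {q : ℝ[X]} (hq : q.Monic) (hdeg : q.natDegree = m)
    {y : Fin m → ℝ} (hy : StrictMono y) (hr : ∀ t, q.IsRoot t ↔ ∃ k, y k = t) {b : ℝ}
    (hb : ∀ k, y k < b) : 0 < q.eval b := by
  rw [eq_nodal_of_roots hq hdeg hy hr, Lagrange.eval_nodal]
  exact Finset.prod_pos fun k _ => sub_pos.2 (hb k)

theorem neg_one_pow_mul_eval_pos_of_lt_roots {m : ℕ} {q : ℝ[X]} (hq : q.Monic)
    (hdeg : q.natDegree = m) {y : Fin m → ℝ} (hy : StrictMono y)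
    (hr : ∀ t, q.IsRoot t ↔ ∃ k, y k = t) {a : ℝ} (ha : ∀ k, a < y k) :
    0 < (-1 : ℝ) ^ m * q.eval a := by
  have h : (-1 : ℝ) ^ m = ∏ _k : Fin m, (-1 : ℝ) := by simp
  rw [eq_nodal_of_roots hq hdeg hy hr, Lagrange.eval_nodal, h, ← Finset.prod_mul_distrib]
  exact Finset.prod_pos fun k _ => by linarith [ha k]

/-! ### Differentiation, raising and lowering relations -/

theorem derivative_jacobiOp (α β : ℝ) (p : ℝ[X]) :
    derivative (jacobiOp α β p) =
      jacobiOp (α + 1) (β + 1) (derivative p) - C (α + β + 2) * derivative p := by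
  simp only [jacobiOp, derivative_mul, derivative_C, derivative_X, derivative_ofNat,
    derivative_X_pow, derivative_one, map_add, map_sub, map_one, map_natCast, C_ofNat]
  push_cast
  ring

/-- Differentiating the differential equation gives the one with both parameters raised by one, so
uniqueness applies. -/
theorem derivative_monicJacobi {α β : ℝ} (hα : -1 < α) (hβ : -1 < β) (n : ℕ) :
    derivative (monicJacobi α β (n + 1)) = C (n + 1 : ℝ) * monicJacobi (α + 1) (β + 1) n := by
  have hn : (n + 1 : ℝ) ≠ 0 := by positivity
  have hC : C (n + 1 : ℝ) * C (n + 1 : ℝ)⁻¹ = 1 := by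
    rw [← C_mul, mul_inv_cancel₀ hn, C_1]
  rw [← eq_monicJacobi_of_ode (α := α + 1) (β := β + 1) (n := n) (by linarith) (by linarith)
    (p := C (n + 1 : ℝ)⁻¹ * derivative (monicJacobi α β (n + 1))), ← mul_assoc, hC, one_mul]
  · rw [coeff_C_mul, coeff_derivative, monicJacobi_coeff_self, one_mul, inv_mul_cancel₀ hn]
  · refine (natDegree_C_mul_le _ _).trans ((natDegree_derivative_le _).trans ?_)
    rw [monicJacobi_natDegree, Nat.add_sub_cancel]
  · have h := congrArg derivative (monicJacobi_ode hα hβ (n + 1))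
    rw [derivative_add, derivative_jacobiOp, derivative_C_mul, derivative_zero] at h
    have hmul : jacobiOp (α + 1) (β + 1) (C (n + 1 : ℝ)⁻¹ * derivative (monicJacobi α β (n + 1)))
        = C (n + 1 : ℝ)⁻¹ *
          jacobiOp (α + 1) (β + 1) (derivative (monicJacobi α β (n + 1))) := by
      simp only [jacobiOp, derivative_C_mul]
      ring
    rw [hmul]
    push_cast at h
    simp only [map_add, map_mul, map_natCast, map_one, C_ofNat] at h ⊢
    linear_combination C (n + 1 : ℝ)⁻¹ * h

/-- The point `(α - β) / (2 n + α + β + 2)` of the raising and lowering relations. -/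
noncomputable def jacobiShift (n : ℕ) (α β : ℝ) : ℝ := (α - β) / (2 * n + α + β + 2)

theorem jacobiShift_mul {α β : ℝ} (hα : -1 < α) (hβ : -1 < β) (n : ℕ) :
    jacobiShift n α β * (2 * n + α + β + 2) = α - β := by
  have : (0 : ℝ) ≤ n := by positivity
  exact div_mul_cancel₀ _ (by linarith)

theorem abs_jacobiShift_lt_one {α β : ℝ} (hα : -1 < α) (hβ : -1 < β) (n : ℕ) :
    |jacobiShift n α β| < 1 := by
  have : (0 : ℝ) ≤ n := by positivity
  have h : 0 < 2 * n + α + β + 2 := by linarith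
  rw [jacobiShift, abs_div, abs_of_pos h, div_lt_one h, abs_lt]
  constructor <;> linarith

theorem monicJacobi_one {α β : ℝ} (hα : -1 < α) (hβ : -1 < β) :
    monicJacobi α β 1 = X + C (jacobiShift 0 α β) := by
  symm
  refine eq_monicJacobi_of_ode hα hβ (by simp) (natDegree_X_add_C _).le ?_
  have h := congrArg (C : ℝ → ℝ[X]) (jacobiShift_mul hα hβ 0)
  simp only [jacobiOp, derivative_X, derivative_C, derivative_one, derivative_zero,
    map_add, map_sub, map_mul, map_one, C_0, C_ofNat, Nat.cast_zero, Nat.cast_one] at h ⊢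
  linear_combination h

theorem natDegree_one_sub_X_sq_mul_derivative_le (p : ℝ[X]) {n : ℕ} (hp : p.natDegree ≤ n) :
    ((1 - X ^ 2) * derivative p).natDegree ≤ n + 1 := by
  rw [natDegree_le_iff_coeff_eq_zero] at hp ⊢
  intro k hk
  obtain ⟨k, rfl⟩ : ∃ j, k = j + 2 := ⟨k - 2, by omega⟩
  rw [sub_mul, one_mul, coeff_sub, coeff_X_pow_mul, coeff_derivative, coeff_derivative,
    hp _ (by omega), hp _ (by omega)]
  ring

/-- The right side solves the equation of degree n+1, so after normalization uniqueness applies. For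
n = 0 the normalizing factor 2n+α+β+1 could vanish. -/
theorem monicJacobi_raising {α β : ℝ} (hα : -1 < α) (hβ : -1 < β) {n : ℕ} (hn : 1 ≤ n) :
    C (2 * n + α + β + 1) * monicJacobi α β (n + 1) =
      C (n + α + β + 1) * (X + C (jacobiShift n α β)) * monicJacobi α β n -
        (1 - X ^ 2) * derivative (monicJacobi α β n) := by
  have hn' : (1 : ℝ) ≤ n := by exact_mod_cast hn
  have hc : 2 * n + α + β + 1 ≠ 0 := by linarith
  have hC : C (2 * n + α + β + 1) * C (2 * n + α + β + 1)⁻¹ = 1 := by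
    rw [← C_mul, mul_inv_cancel₀ hc, C_1]
  set P := monicJacobi α β n with hP
  set R := C (n + α + β + 1) * (X + C (jacobiShift n α β)) * P - (1 - X ^ 2) * derivative P with hR
  rw [← eq_monicJacobi_of_ode hα hβ (n := n + 1) (p := C (2 * n + α + β + 1)⁻¹ * R),
    ← mul_assoc, hC, one_mul]
  · have : R.coeff (n + 1) = 2 * n + α + β + 1 := by
      obtain ⟨m, rfl⟩ : ∃ m, n = m + 1 := ⟨n - 1, by omega⟩
      rw [hR, mul_assoc, coeff_sub, coeff_C_mul, add_mul X, coeff_add, coeff_X_mul, coeff_C_mul,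
        sub_mul, one_mul, coeff_sub, coeff_X_pow_mul, coeff_derivative, coeff_derivative, hP,
        monicJacobi_coeff_self, monicJacobi_coeff_of_lt α β (by omega : m + 1 < m + 1 + 1),
        monicJacobi_coeff_of_lt α β (by omega : m + 1 < m + 1 + 1 + 1)]
      push_cast
      ring
    rw [coeff_C_mul, this, inv_mul_cancel₀ hc]
  · refine (natDegree_C_mul_le _ _).trans ((natDegree_sub_le_iff_left ?_).2 ?_)
    · exact natDegree_one_sub_X_sq_mul_derivative_le P (monicJacobi_natDegree α β n).le
    · rw [mul_assoc]
      refine (natDegree_C_mul_le _ _).trans (natDegree_mul_le.trans ?_)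
      rw [natDegree_X_add_C, monicJacobi_natDegree, add_comm]
  · have h := monicJacobi_ode hα hβ n
    have h' := congrArg derivative h
    have he := congrArg (C : ℝ → ℝ[X]) (jacobiShift_mul hα hβ n)
    rw [derivative_add, derivative_jacobiOp, derivative_C_mul, derivative_zero] at h'
    -- A combination of the equation for P and its derivative; the multiple of P left over vanishes
    -- exactly by the choice of `jacobiShift`.
    have key : jacobiOp α β R + C ((n + 1 : ℝ) * (n + 1 + α + β + 1)) * R = 0 := by
      rw [hR]
      simp only [jacobiOp, derivative_mul, derivative_C, derivative_natCast,
        derivative_X, derivative_X_pow, derivative_one, map_add, map_sub, map_one, map_natCast,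
        C_ofNat, map_mul, ← hP, derivative_zero] at h h' he ⊢
      push_cast at h h' ⊢
      linear_combination (-(1 - X ^ 2)) * h' +
        ((n + C α + C β + 1) * (X + C (jacobiShift n α β)) + 2 * X) * h +
        (n + C α + C β + 1) * P * he
    have hmul : jacobiOp α β (C (2 * n + α + β + 1)⁻¹ * R) =
        C (2 * n + α + β + 1)⁻¹ * jacobiOp α β R := by
      simp only [jacobiOp, derivative_C_mul]
      ring
    rw [hmul]
    push_cast
    linear_combination C (2 * n + α + β + 1)⁻¹ * key

theorem monicJacobi_raising_eval {α β : ℝ} (hα : -1 < α) (hβ : -1 < β) {n : ℕ} (hn : 1 ≤ n)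
    (t : ℝ) : (2 * n + α + β + 1) * (monicJacobi α β (n + 1)).eval t =
      (n + α + β + 1) * (t + jacobiShift n α β) * (monicJacobi α β n).eval t -
        (1 - t ^ 2) * (derivative (monicJacobi α β n)).eval t := by
  simpa using congrArg (eval t) (monicJacobi_raising hα hβ hn)

/-- Differentiate the raising relation and eliminate the second derivative by the differential
equation; a factor n+1 cancels. -/
theorem monicJacobi_add_one_eval {α β : ℝ} (hα : -1 < α) (hβ : -1 < β) {n : ℕ} (hn : 1 ≤ n)
    (t : ℝ) : (2 * n + α + β + 1) * (monicJacobi (α + 1) (β + 1) n).eval t =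
      (n + α + β + 1) * (monicJacobi α β n).eval t +
        (t - jacobiShift n α β) * (derivative (monicJacobi α β n)).eval t := by
  have h1 := congrArg (fun p => eval t (derivative p)) (monicJacobi_raising hα hβ hn)
  have h2 := congrArg (eval t) (monicJacobi_ode hα hβ n)
  have h3 := jacobiShift_mul hα hβ n
  simp only [derivative_C_mul, derivative_monicJacobi hα hβ] at h1
  simp only [jacobiOp, derivative_sub, derivative_add, derivative_mul, derivative_C, derivative_X,
    derivative_one, derivative_X_pow, eval_add, eval_sub, eval_mul, eval_C, eval_X, eval_pow,
    eval_one, eval_zero] at h1 h2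
  have hn0 : (n + 1 : ℝ) ≠ 0 := by positivity
  refine mul_left_cancel₀ hn0 ?_
  norm_num at h1
  linear_combination h1 - h2 + (derivative (monicJacobi α β n)).eval t * h3

/-- Eliminates the derivative between the two preceding relations. -/
theorem monicJacobi_lowering_eval {α β : ℝ} (hα : -1 < α) (hβ : -1 < β) {n : ℕ} (hn : 1 ≤ n)
    (t : ℝ) : (n + α + β + 1) * (1 - jacobiShift n α β ^ 2) * (monicJacobi α β n).eval t =
      (2 * n + α + β + 1) * ((t - jacobiShift n α β) * (monicJacobi α β (n + 1)).eval t +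
        (1 - t ^ 2) * (monicJacobi (α + 1) (β + 1) n).eval t) := by
  linear_combination (-(t - jacobiShift n α β)) * monicJacobi_raising_eval hα hβ hn t -
    (1 - t ^ 2) * monicJacobi_add_one_eval hα hβ hn t

/-! ### Location of the zeros -/

/-- The zeros of Jacobi polynomials are real, simple and lie in `(-1, 1)`. -/
theorem monicJacobi_exists_roots {α β : ℝ} (hα : -1 < α) (hβ : -1 < β) {n : ℕ} (hn : 1 ≤ n) :
    ∃ y : Fin n → ℝ, StrictMono y ∧ (∀ t, (monicJacobi α β n).IsRoot t ↔ ∃ k, y k = t) ∧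
      ∀ k, -1 < y k ∧ y k < 1 := by
  induction n, hn using Nat.le_induction with
  | base =>
    have he := abs_lt.1 (abs_jacobiShift_lt_one hα hβ 0)
    refine ⟨fun _ => -jacobiShift 0 α β, Subsingleton.strictMono _, fun t => ?_, fun _ => ?_⟩
    · rw [monicJacobi_one hα hβ, IsRoot.def, eval_add, eval_X, eval_C, exists_const]
      constructor <;> intro h <;> linarith
    · constructor <;> linarith
  | succ n hn ih =>
    obtain ⟨y, hy, hr, hy1⟩ := ih
    have hn' : (1 : ℝ) ≤ n := by exact_mod_cast hn
    have hc : 0 < 2 * n + α + β + 1 := by linarith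
    have hA : 0 < n + α + β + 1 := by linarith
    have he := abs_lt.1 (abs_jacobiShift_lt_one hα hβ n)
    have hmon := monicJacobi_monic α β n
    have hdeg := monicJacobi_natDegree α β n
    -- By the raising relation, at zeros of the degree-n polynomial the next one is a negative
    -- multiple of the derivative. At ±1 the derivative term drops out, and |`jacobiShift`| < 1
    -- fixes the sign.
    obtain ⟨x, hx, hxr, hx1, -⟩ := exists_roots_of_eval_derivative_neg
      (monicJacobi_natDegree α β (n + 1)) hmon hdeg hy hr (fun k => by
        have h := monicJacobi_raising_eval hα hβ hn (y k)
        have h0 : (monicJacobi α β n).eval (y k) = 0 := (hr _).2 ⟨k, rfl⟩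
        have hd : (derivative (monicJacobi α β n)).eval (y k) ≠ 0 :=
          right_ne_zero_of_mul (neg_one_pow_mul_eval_derivative_pos hmon hdeg hy hr k).ne'
        have hd2 := mul_pos (mul_pos (sub_pos.2 (hy1 k).2) (neg_lt_iff_pos_add.1 (hy1 k).1))
          (pow_pos (abs_pos.2 hd) 2)
        rw [sq_abs] at hd2
        rw [h0] at h
        refine (pos_iff_neg_of_mul_neg (a := 2 * n + α + β + 1) ?_).1 hc
        rw [← neg_pos]
        refine hd2.trans_eq ?_
        linear_combination (derivative (monicJacobi α β n)).eval (y k) * h) (by norm_num : (-1 : ℝ) < 1) (fun k => (hy1 k).1) (fun k => (hy1 k).2)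
      (by
        have h := monicJacobi_raising_eval hα hβ hn (-1)
        have h1 := neg_one_pow_mul_eval_pos_of_lt_roots hmon hdeg hy hr fun k => (hy1 k).1
        have h2 := mul_pos (mul_pos hA (by linarith : 0 < 1 - jacobiShift n α β)) h1
        refine (mul_pos_iff_of_pos_left hc).1 ?_
        rw [pow_succ]
        linear_combination h2 + (-1 : ℝ) ^ n * h)
      (by
        have h := monicJacobi_raising_eval hα hβ hn 1
        have h1 := eval_pos_of_roots_lt hmon hdeg hy hr fun k => (hy1 k).2
        have h2 := mul_pos (mul_pos hA (by linarith : 0 < 1 + jacobiShift n α β)) h1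
        refine (mul_pos_iff_of_pos_left hc).1 ?_
        linear_combination h2 - h)
    exact ⟨x, hx, hxr, hx1⟩

/-! ### The extra points and the sign identities -/

theorem jacobiΔ_nonneg {α β : ℝ} (hα : -1 < α) (hβ : -1 < β) (n : ℕ) : 0 ≤ jacobiΔ n α β := by
  have hn : (0 : ℝ) ≤ n := by positivity
  have h1 : 0 < α + β + 2 := by linarith
  have h2 : 0 < 2 * n + α + β + 4 := by linarith
  have h3 : 0 < 2 * n + α + β + 3 := by linarith
  have h4 : 0 < n + α + 1 := by linarith
  have h5 : 0 < n + β + 1 := by linarith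
  have h6 : 0 < n + α + β + 2 := by linarith
  unfold jacobiΔ
  positivity

/-- Explains M and Δ: E₁ and E₂ are the roots of the quadratic on the right, which is the factor
arising in `monicJacobi_eval_of_isRoot`. -/
theorem sub_jacobiE_mul {α β : ℝ} (hα : -1 < α) (hβ : -1 < β) (n : ℕ) (t : ℝ) :
    (2 * n + α + β + 3) * ((t - jacobiE₁ n α β) * (t - jacobiE₂ n α β)) =
      (n + 1) * (t - jacobiShift n α β) * (t - jacobiShift (n + 1) α β) -
        (n + α + β + 2) * (1 - t ^ 2) := by
  have hn : (0 : ℝ) ≤ n := by positivity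
  have h2 : 2 * n + α + β + 4 ≠ 0 := by linarith
  have h3 : 2 * n + α + β + 3 ≠ 0 := by linarith
  have h4 : 2 * n + α + β + 2 ≠ 0 := by linarith
  have hs := Real.sq_sqrt (jacobiΔ_nonneg hα hβ n)
  have h : (t - jacobiE₁ n α β) * (t - jacobiE₂ n α β) =
      t ^ 2 - jacobiM n α β * t + (jacobiM n α β ^ 2 - jacobiΔ n α β) / 4 := by
    unfold jacobiE₁ jacobiE₂
    linear_combination (-1 / 4) * hs
  have h2' : 2 * (n + 1 : ℝ) + α + β + 2 = 2 * n + α + β + 4 := by ring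
  rw [h]
  simp only [jacobiΔ, jacobiM, jacobiShift, Nat.cast_add, Nat.cast_one, h2']
  field_simp
  ring

theorem jacobiE₁_le_jacobiE₂ (n : ℕ) (α β : ℝ) : jacobiE₁ n α β ≤ jacobiE₂ n α β := by
  unfold jacobiE₁ jacobiE₂
  linarith [Real.sqrt_nonneg (jacobiΔ n α β)]

/-- At such t, `monicJacobi_add_one_eval` in degree n+1 expresses `monicJacobi α β (n + 1)` through
`monicJacobi (α + 1) (β + 1) n`; substitute this into the lowering relation. -/
theorem monicJacobi_eval_of_isRoot {α β : ℝ} (hα : -1 < α) (hβ : -1 < β) {n : ℕ} (hn : 1 ≤ n)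
    {t : ℝ} (ht : (monicJacobi (α + 1) (β + 1) (n + 1)).IsRoot t) :
    (n + α + β + 1) * (n + α + β + 2) * (1 - jacobiShift n α β ^ 2) *
        (monicJacobi α β n).eval t =
      -((2 * n + α + β + 1) * (2 * n + α + β + 3) *
        ((t - jacobiE₁ n α β) * (t - jacobiE₂ n α β)) *
          (monicJacobi (α + 1) (β + 1) n).eval t) := by
  have h1 := monicJacobi_lowering_eval hα hβ hn t
  have h2 := monicJacobi_add_one_eval hα hβ (by omega : 1 ≤ n + 1) t
  rw [ht.eq_zero, derivative_monicJacobi hα hβ, eval_mul, eval_C] at h2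
  have h3 := sub_jacobiE_mul hα hβ n t
  push_cast at h2
  linear_combination (n + α + β + 2) * h1 -
    (2 * n + α + β + 1) * (t - jacobiShift n α β) * h2 +
    (2 * n + α + β + 1) * (monicJacobi (α + 1) (β + 1) n).eval t * h3

/-- At a zero of the higher polynomial the lowering relation makes the lower one a positive multiple
of (1-t²) times the derivative. -/
theorem monicJacobi_mul_derivative_pos_of_isRoot {α β : ℝ} (hα : -1 < α) (hβ : -1 < β) {n : ℕ}
    (hn : 1 ≤ n) {t : ℝ} (ht : (monicJacobi α β (n + 1)).IsRoot t) (ht1 : -1 < t ∧ t < 1)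
    (hd : (derivative (monicJacobi α β (n + 1))).eval t ≠ 0) :
    0 < (monicJacobi α β n).eval t * (derivative (monicJacobi α β (n + 1))).eval t := by
  have hn' : (1 : ℝ) ≤ n := by exact_mod_cast hn
  have hA : 0 < (n + α + β + 1) * (1 - jacobiShift n α β ^ 2) * (n + 1) :=
    mul_pos (mul_pos (by linarith)
      (by linarith [(sq_lt_one_iff_abs_lt_one _).2 (abs_jacobiShift_lt_one hα hβ n)]))
      (by positivity)
  have h := monicJacobi_lowering_eval hα hβ hn t
  have h2 := congrArg (eval t) (derivative_monicJacobi hα hβ n)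
  rw [ht.eq_zero] at h
  rw [eval_mul, eval_C] at h2
  have hpos : 0 < (2 * n + α + β + 1) * ((1 - t) * (1 + t)) *
      |(derivative (monicJacobi α β (n + 1))).eval t| ^ 2 :=
    mul_pos (mul_pos (by linarith) (mul_pos (by linarith) (by linarith))) (pow_pos (abs_pos.2 hd) 2)
  rw [sq_abs] at hpos
  refine (mul_pos_iff_of_pos_left hA).1 (hpos.trans_eq ?_)
  rw [h2]
  linear_combination (-(n + 1) ^ 2 * (monicJacobi (α + 1) (β + 1) n).eval t) * h

/-! ### The two interlacings -/

theorem corollary3p1 (n : ℕ) (hn : 1 ≤ n) (α β : ℝ) (hα : -1 < α) (hβ : -1 < β)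
    (hcommon : ∀ t : ℝ, ¬ ((monicJacobi α β n).IsRoot t ∧
      (monicJacobi (α + 1) (β + 1) (n + 1)).IsRoot t)) :
    Interlaces ((X - C (jacobiE₁ n α β)) * (X - C (jacobiE₂ n α β)) * monicJacobi α β n)
      (monicJacobi (α + 1) (β + 1) (n + 1)) ∧
    ((∀ y : ℝ, (monicJacobi (α + 1) (β + 1) (n + 1)).IsRoot y →
        jacobiE₁ n α β < y ∧ y < jacobiE₂ n α β) →
      Interlaces (monicJacobi (α + 1) (β + 1) (n + 1)) (monicJacobi α β n)) := by
  have hα' : -1 < α + 1 := by linarith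
  have hβ' : -1 < β + 1 := by linarith
  have hn' : (1 : ℝ) ≤ n := by exact_mod_cast hn
  set Q := monicJacobi (α + 1) (β + 1) (n + 1) with hQ
  have hQm : Q.Monic := monicJacobi_monic _ _ _
  have hQd : Q.natDegree = n + 1 := monicJacobi_natDegree _ _ _
  have hPm := monicJacobi_monic α β n
  have hPd := monicJacobi_natDegree α β n
  obtain ⟨y, hy, hyr, hy1⟩ := monicJacobi_exists_roots hα' hβ' (by omega : 1 ≤ n + 1)
  obtain ⟨z, hz, hzr, hz1⟩ := monicJacobi_exists_roots hα hβ hn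
  have hK : 0 < (n + α + β + 1) * (n + α + β + 2) * (1 - jacobiShift n α β ^ 2) :=
    mul_pos (mul_pos (by linarith) (by linarith))
      (by linarith [(sq_lt_one_iff_abs_lt_one _).2 (abs_jacobiShift_lt_one hα hβ n)])
  have hL : 0 < (2 * n + α + β + 1) * (2 * n + α + β + 3) := mul_pos (by linarith) (by linarith)
  have hroot : ∀ k, Q.IsRoot (y k) := fun k => (hyr _).2 ⟨k, rfl⟩
  have hsign : ∀ k, 0 < (monicJacobi (α + 1) (β + 1) n).eval (y k) * (derivative Q).eval (y k) :=
    fun k => monicJacobi_mul_derivative_pos_of_isRoot hα' hβ' hn (hroot k) (hy1 k)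
      (right_ne_zero_of_mul (neg_one_pow_mul_eval_derivative_pos hQm hQd hy hyr k).ne')
  have hkey := fun k => monicJacobi_eval_of_isRoot hα hβ hn (hroot k)
  -- A zero of Q at E₁ or E₂ would, by `hkey`, also be a zero of P.
  have hG : ∀ k, (y k - jacobiE₁ n α β) * (y k - jacobiE₂ n α β) ≠ 0 := by
    intro k h0
    have h := hkey k
    rw [h0, mul_zero, zero_mul, neg_zero] at h
    exact hcommon _ ⟨(mul_eq_zero.1 h).resolve_left hK.ne', hroot k⟩
  constructor
  -- The endpoints lie beyond ±1 and both extra points, so every factor has a known sign there.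
  · set a := min (-1) (jacobiE₁ n α β) - 1 with ha
    set b := max 1 (jacobiE₂ n α β) + 1 with hb
    have ha1 : a < -1 := by linarith [min_le_left (-1) (jacobiE₁ n α β)]
    have ha2 : a < jacobiE₁ n α β := by linarith [min_le_right (-1) (jacobiE₁ n α β)]
    have hb1 : 1 < b := by linarith [le_max_left 1 (jacobiE₂ n α β)]
    have hb2 : jacobiE₂ n α β < b := by linarith [le_max_right 1 (jacobiE₂ n α β)]
    have hE := jacobiE₁_le_jacobiE₂ n α β
    have hpd : ((X - C (jacobiE₁ n α β)) * (X - C (jacobiE₂ n α β)) *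
        monicJacobi α β n).natDegree = n + 1 + 1 := by
      rw [((monic_X_sub_C _).mul (monic_X_sub_C _)).natDegree_mul hPm,
        (monic_X_sub_C _).natDegree_mul (monic_X_sub_C _), natDegree_X_sub_C, natDegree_X_sub_C,
        hPd]
      ring
    have heval : ∀ t, ((X - C (jacobiE₁ n α β)) * (X - C (jacobiE₂ n α β)) *
        monicJacobi α β n).eval t =
          (t - jacobiE₁ n α β) * (t - jacobiE₂ n α β) * (monicJacobi α β n).eval t := fun t => by
      rw [eval_mul, eval_mul, eval_sub, eval_sub, eval_X, eval_C, eval_C]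
    obtain ⟨x, hx, hxr, -, hxy⟩ := exists_roots_of_eval_derivative_neg hpd hQm hQd hy hyr
      (fun k => by
        rw [heval]
        -- The quadratic occurs once in the product and once in `hkey`, hence squared: its sign is
        -- irrelevant.
        have h1 := mul_pos (mul_pos hL (pow_pos (abs_pos.2 (hG k)) 2)) (hsign k)
        have hk := hkey k
        rw [sq_abs] at h1
        generalize (y k - jacobiE₁ n α β) * (y k - jacobiE₂ n α β) = g at h1 hk ⊢
        refine (pos_iff_neg_of_mul_neg ?_).1 hK
        rw [← neg_pos]
        refine h1.trans_eq ?_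
        linear_combination (g * (derivative Q).eval (y k)) * hk)
      (by linarith : a < b) (fun k => ha1.trans (hy1 k).1) (fun k => (hy1 k).2.trans hb1)
      (by
        rw [heval]
        have h := neg_one_pow_mul_eval_pos_of_lt_roots hPm hPd hz hzr
          fun k => ha1.trans (hz1 k).1
        have h' := mul_pos (mul_pos (sub_pos.2 ha2) (sub_pos.2 (ha2.trans_le hE))) h
        refine h'.trans_eq ?_
        ring)
      (by
        rw [heval]
        have h := eval_pos_of_roots_lt hPm hPd hz hzr fun k => (hz1 k).2.trans hb1
        exact mul_pos (mul_pos (sub_pos.2 (hE.trans_lt hb2)) (sub_pos.2 hb2)) h)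
    exact ⟨n + 1, x, y, hpd, hQd, hx, hy, hxr, hyr, hxy⟩
  · intro hE
    refine interlaces_of_eval_derivative_pos hPd hQm hQd hy hyr fun k => ?_
    have hEk := hE _ (hroot k)
    -- Between E₁ and E₂ the quadratic is negative, cancelling the minus sign in `hkey`.
    have h1 := mul_pos (mul_pos hL (mul_pos (sub_pos.2 hEk.1) (sub_pos.2 hEk.2))) (hsign k)
    refine (mul_pos_iff_of_pos_left hK).1 (h1.trans_eq ?_)
    linear_combination (-(derivative Q).eval (y k)) * hkey k
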